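/- Let $G$ be a finite group, $R$ an associative ring with unity, $R^*$ its group of units, and $\rho\colon G\to R^*$ a group homomorphism (for example, a linear representation $G\to\mathbf{GL}(V)$, with $R=\mathrm{End}(V)$). Let $m\ge 1$ and $k\ge 0$ be integers, let $u_1,\dots,u_k\in F(x_1,\dots,x_m)$ be elements of the free group of rank $m$, and let $l_1,\dots,l_k\in\mathbb Z$. For an integer $n$, let $\mathrm{GCD}(G,n)$ denote the least common multiple of the orders of those subgroups of $G$ whose order divides $n$ (so $\mathrm{GCD}(G,0)=|G|$). Let $N$ be the number of tuples $(x_1,\dots,x_m)\in G^m$ satisfying $$\sum_{i=1}^k \bigl(\rho(u_i(x_1,\dots,x_m))\bigr)^{l_i}=1\quad\text{in } R.$$ Then: 1. $N$ is divisible by $\mathrm{GCD}(G,\gcd(l_1,\dots,l_k))$; 2. if $k\le m$, then $N$ is divisible by $\mathrm{GCD}(G,\mathrm{lcm}(l_1,\dots,l_k))$; 3. if $k<m$, then $N$ is divisible by $|G|$. Here $\gcd$ and $\mathrm{lcm}$ of an empty family are $0$ and $1$ respectively, $\gcd(0,\dots,0)=0$, and an $\mathrm{lcm}$ of a family containing $0$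 is $0$. -/

import Mathlib

/-- `GCD(G, n)` for a finite group `G` and an integer `n`: the least common multiple of the orders
of those subgroups of `G` whose order divides `n`. -/
noncomputable def groupGCD (G : Type*) [Group G] [Finite G] (n : ℤ) : ℕ :=
  (Set.toFinite {H : Subgroup G | (Nat.card H : ℤ) ∣ n}).toFinset.lcm fun H => Nat.card H

/-- The tuples `x = (x₁, …, xₘ) ∈ Gᵐ` with `∑ᵢ ρ(uᵢ(x)) ^ lᵢ = 1` in `R`. The powers are taken in the
group of units, the sum in the ring. -/
def solutionSet {G R : Type*} [Group G] [Ring R] (ρ : G →* Rˣ) {k m : ℕ}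
    (u : Fin k → FreeGroup (Fin m)) (l : Fin k → ℤ) : Set (Fin m → G) :=
  {x | ∑ i : Fin k, ((ρ (FreeGroup.lift x (u i)) ^ l i : Rˣ) : R) = 1}

/-!
A tuple in `G ^ m` is a homomorphism from the free group `F` of rank `m` to `G`. Choose a normal
subgroup `D` of `F` containing all `uᵢ ^ lᵢ`, with `F ⧸ D` cyclic and `t` a generator, and let `H`
be a `p`-subgroup of `G` whose order divides the index of `D`. Whether `φ : F →* G` is a solution
depends only on its restriction to `D`, and `H` permutes the solutions by conjugation. Attach to
`φ` the pair consisting of `φ` on `D` and the map `f ↦ φ f H`. The homomorphisms `ψ` with the same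
pair as `φ` correspond bijectively, via `ψ ↦ (φ t)⁻¹ ψ t`, to the elements of the stabilizer of that
pair in `H`; surjectivity rests on the identity `(g k) ^ n = g ^ n` for `k` in a `p`-group that `g`
normalizes and `g ^ n` centralizes, when `n` is a multiple of its order. By Burnside's lemma the
number of solutions is `|H|` times the number of orbits of pairs.

If fewer than `m` of the `uᵢ` are singled out, they are killed by a surjection `F → ℤ`, which
provides a suitable `D` as soon as `|H|` divides the remaining exponents `lᵢ`. A prime power
dividing the least common multiple divides some `lᵢ`, so that at most `m - 1` of the `uᵢ` have to be
singled out when `k ≤ m`.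
-/

open MulAction

theorem card_dvd_card_of_fiber_equiv_stabilizer {H X Y : Type*} [Group H] [MulAction H Y]
    (π : X → Y) (hrange : ∀ (h : H) (x : X), h • π x ∈ Set.range π)
    (hfiber : ∀ x, Nonempty ({x' // π x' = π x} ≃ stabilizer H (π x))) :
    Nat.card H ∣ Nat.card X := by
  let S : SubMulAction H Y :=
    { carrier := Set.range π
      smul_mem' := by rintro h _ ⟨x, rfl⟩; exact hrange h x }
  have hfiber' (y : S) : Nonempty ({x // Set.rangeFactorization π x = y} ≃ stabilizer H y) := by
    obtain ⟨_, x, rfl⟩ := y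
    rw [SubMulAction.stabilizer_of_subMul]
    exact (hfiber x).map ((Equiv.subtypeEquivRight fun _ => Subtype.ext_iff).trans ·)
  have hcard : Nat.card X = Nat.card (orbitRel.Quotient H S × H) := Nat.card_congr <|
    calc X ≃ Σ y : S, {x // Set.rangeFactorization π x = y} := (Equiv.sigmaFiberEquiv _).symm
      _ ≃ Σ y : S, stabilizer H y := Equiv.sigmaCongrRight fun y => (hfiber' y).some
      _ ≃ {yh : S × H // yh.2 • yh.1 = yh.1} := (Equiv.subtypeProdEquivSigmaSubtype
          fun (y : S) (h : H) => h ∈ stabilizer H y).symm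
      _ ≃ {hy : H × S // hy.1 • hy.2 = hy.2} :=
        (Equiv.prodComm S H).subtypeEquiv fun _ => Iff.rfl
      _ ≃ Σ h : H, fixedBy S h := Equiv.subtypeProdEquivSigmaSubtype fun h y => h • y = y
      _ ≃ orbitRel.Quotient H S × H := sigmaFixedByEquivOrbitsProdGroup H S
  rw [hcard, Nat.card_prod]
  exact dvd_mul_left _ _

theorem isPeriodicPt_prime_pow_of_card_le {α : Type*} [Finite α] {f : α → α} {x : α} {p a m : ℕ}
    (hp : p.Prime) (hx : Function.IsPeriodicPt f (p ^ m) x) (hα : Nat.card α ≤ p ^ a) :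
    Function.IsPeriodicPt f (p ^ a) x := by
  have := Fintype.ofFinite α
  obtain ⟨c, -, hc⟩ := (Nat.dvd_prime_pow hp).1 hx.minimalPeriod_dvd
  have hle : p ^ c ≤ p ^ a := by
    rw [← hc]
    exact Function.minimalPeriod_le_card.trans (Nat.card_eq_fintype_card.symm.trans_le hα)
  rw [Function.isPeriodicPt_iff_minimalPeriod_dvd, hc]
  exact pow_dvd_pow p ((Nat.pow_le_pow_iff_right hp.one_lt).1 hle)

section Group

variable {G : Type*} [Group G] {K : Subgroup G} {g k : G}

theorem inv_zpow_mul_mul_zpow_mem (hg : g ∈ Subgroup.normalizer (K : Set G)) (hk : k ∈ K) (n : ℤ) :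
    (g ^ n)⁻¹ * (g * k) ^ n ∈ K := by
  let N := Subgroup.normalizer (K : Set G)
  let g' : N := ⟨g, hg⟩
  let k' : N := ⟨k, Subgroup.le_normalizer hk⟩
  let q : N →* N ⧸ K.subgroupOf N := QuotientGroup.mk' _
  have hq : q (g' * k') = q g' := QuotientGroup.mk_mul_of_mem g' hk
  have hmem : (g' ^ n)⁻¹ * (g' * k') ^ n ∈ K.subgroupOf N := by
    rw [← QuotientGroup.eq]
    change q (g' ^ n) = q ((g' * k') ^ n)
    rw [map_zpow, map_zpow, hq]
  exact hmem

theorem mul_pow_eq_pow_of_card_eq_prime_pow {p a : ℕ} (hp : p.Prime) (hK : Nat.card K = p ^ a)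
    (hg : g ∈ Subgroup.normalizer (K : Set G))
    (hcent : g ^ p ^ a ∈ Subgroup.centralizer (K : Set G)) (hk : k ∈ K) :
    (g * k) ^ p ^ a = g ^ p ^ a := by
  have : Finite K := Nat.finite_of_card_ne_zero (hK ▸ (pow_pos hp.pos a).ne')
  let f : K → K := fun y => ⟨g⁻¹ * y * g * k,
    K.mul_mem ((Subgroup.mem_normalizer_iff''.1 hg _).1 y.2) hk⟩
  have iterate_f (n : ℕ) : ((f^[n] 1 : K) : G) = (g ^ n)⁻¹ * (g * k) ^ n := by
    induction n with
    | zero => simp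
    | succ n ih =>
      rw [Function.iterate_succ_apply']
      change g⁻¹ * (f^[n] 1 : K) * g * k = _
      rw [ih, pow_succ, pow_succ]
      group
  have f_periodic_iff (n : ℕ) : Function.IsPeriodicPt f n 1 ↔ (g * k) ^ n = g ^ n := by
    rw [Function.IsPeriodicPt, Function.IsFixedPt, Subtype.ext_iff, iterate_f, OneMemClass.coe_one,
      inv_mul_eq_one, eq_comm]
  rw [← f_periodic_iff]
  refine isPeriodicPt_prime_pow_of_card_le (m := a + a) hp ?_ hK.le
  rw [f_periodic_iff]
  set y : K := f^[p ^ a] 1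
  have hy : (g * k) ^ p ^ a = g ^ p ^ a * y := by rw [iterate_f, mul_inv_cancel_left]
  have hcomm : Commute (g ^ p ^ a) y := (hcent y y.2).symm
  have hy_pow : (y : G) ^ p ^ a = 1 := by rw [← hK]; exact_mod_cast pow_card_eq_one' (x := y)
  rw [pow_add, pow_mul, hy, hcomm.mul_pow, hy_pow, mul_one, pow_mul]

theorem mul_pow_eq_pow_of_card_dvd {p a n : ℕ} (hp : p.Prime) (hK : Nat.card K = p ^ a)
    (hn : Nat.card K ∣ n) (hg : g ∈ Subgroup.normalizer (K : Set G))
    (hcent : g ^ n ∈ Subgroup.centralizer (K : Set G)) (hk : k ∈ K) :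
    (g * k) ^ n = g ^ n := by
  obtain ⟨r, rfl⟩ := hn
  rw [hK, mul_comm, pow_mul] at hcent
  have hk_r : (g ^ r)⁻¹ * (g * k) ^ r ∈ K := by
    exact_mod_cast inv_zpow_mul_mul_zpow_mem hg hk r
  have h := mul_pow_eq_pow_of_card_eq_prime_pow hp hK (pow_mem hg r) hcent hk_r
  rwa [mul_inv_cancel_left, ← pow_mul, ← pow_mul, ← hK, mul_comm r] at h

theorem exists_le_card_eq_prime_pow {H : Subgroup G} [Finite H] {p a : ℕ} (hp : p.Prime)
    (h : p ^ a ∣ Nat.card H) : ∃ P ≤ H, Nat.card P = p ^ a := by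
  have := Fact.mk hp
  obtain ⟨P, hP⟩ := Sylow.exists_subgroup_card_pow_prime p h
  exact ⟨P.map H.subtype, Subgroup.map_subtype_le P, (Subgroup.card_subtype H P).trans hP⟩

end Group

/-- Conjugation of homomorphisms into `G` by elements of `G`: `(g • φ) f = g * φ f * g⁻¹`. -/
local instance conjHomAction {F G : Type*} [Group F] [Group G] : MulAction G (F →* G) where
  smul g φ := (MulAut.conj g).toMonoidHom.comp φ
  one_smul φ := by
    ext f
    change 1 * φ f * 1⁻¹ = φ f
    simp
  mul_smul g h φ := by
    ext f
    change g * h * φ f * (g * h)⁻¹ = g * (h * φ f * h⁻¹) * g⁻¹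
    group

theorem smul_hom_apply {F G : Type*} [Group F] [Group G] (g : G) (φ : F →* G) (f : F) :
    (g • φ) f = g * φ f * g⁻¹ := rfl

section Hom

variable {F G : Type*} [Group F] [Group G] {D : Subgroup F} {t : F}

theorem exists_mul_zpow_eq [D.Normal] (ht : ∀ x : F ⧸ D, x ∈ Subgroup.zpowers (t : F ⧸ D))
    (f : F) : ∃ d ∈ D, ∃ n : ℤ, d * t ^ n = f := by
  obtain ⟨n, hn⟩ := Subgroup.mem_zpowers_iff.1 (ht f)
  rw [← QuotientGroup.mk_zpow, QuotientGroup.eq] at hn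
  exact ⟨f * (t ^ n)⁻¹, (Subgroup.Normal.mem_comm_iff ‹_›).1 hn, n, inv_mul_cancel_right f _⟩

theorem hom_ext_of_forall_mem_zpowers [D.Normal]
    (ht : ∀ x : F ⧸ D, x ∈ Subgroup.zpowers (t : F ⧸ D)) {φ ψ : F →* G}
    (hD : ∀ d ∈ D, φ d = ψ d) (h : φ t = ψ t) : φ = ψ := by
  ext f
  obtain ⟨d, hd, n, rfl⟩ := exists_mul_zpow_eq ht f
  simp only [map_mul, map_zpow, hD d hd, h]

theorem map_conjNormal_zpow [D.Normal] {α : D →* G} {s : G}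
    (hconj : ∀ d, α (MulAut.conjNormal t d) = s * α d * s⁻¹) (n : ℤ) (d : D) :
    α (MulAut.conjNormal (t ^ n) d) = s ^ n * α d * (s ^ n)⁻¹ := by
  induction n using Int.induction_on generalizing d with
  | zero => simp
  | succ n ih =>
    rw [zpow_add_one, map_mul, MulAut.mul_apply, ih, hconj, zpow_add_one]
    group
  | pred n ih =>
    have hinv : α (MulAut.conjNormal t⁻¹ d) = s⁻¹ * α d * s := by
      have := hconj (MulAut.conjNormal t⁻¹ d)
      rw [← MulAut.mul_apply, ← map_mul, mul_inv_cancel, map_one, MulAut.one_apply] at this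
      rw [this]
      group
    rw [zpow_sub_one, map_mul, MulAut.mul_apply, ih, hinv, zpow_sub_one]
    group

theorem exists_hom_extending [D.Normal]
    (ht : ∀ x : F ⧸ D, x ∈ Subgroup.zpowers (t : F ⧸ D)) (α : D →* G) (s : G)
    (hconj : ∀ d, α (MulAut.conjNormal t d) = s * α d * s⁻¹)
    (hpow : ∀ d : D, ∀ n : ℤ, (d : F) = t ^ n → α d = s ^ n) :
    ∃ ψ : F →* G, (∀ d : D, ψ d = α d) ∧ ψ t = s := by
  let π : D ⋊[MulAut.conjNormal.comp (zpowersHom F t)] Multiplicative ℤ →* F :=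
    SemidirectProduct.lift D.subtype (zpowersHom F t) fun n => by
      ext d
      simp [-map_zpow]
  let σ : D ⋊[MulAut.conjNormal.comp (zpowersHom F t)] Multiplicative ℤ →* G :=
    SemidirectProduct.lift α (zpowersHom G s) fun n => by
      ext d
      simpa [-map_zpow] using map_conjNormal_zpow hconj n.toAdd d
  have hπ : Function.Surjective π := fun f => by
    obtain ⟨d, hd, n, rfl⟩ := exists_mul_zpow_eq ht f
    exact ⟨.inl ⟨d, hd⟩ * .inr (.ofAdd n), by simp [π]⟩
  have hker : π.ker ≤ σ.ker := fun x hx => by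
    have hx' : (x.left : F) * t ^ x.right.toAdd = 1 := hx
    change α x.left * s ^ x.right.toAdd = 1
    have hleft : (x.left : F) = t ^ (-x.right.toAdd) := by
      rw [zpow_neg, ← mul_eq_one_iff_eq_inv, hx']
    rw [hpow x.left _ hleft, zpow_neg, inv_mul_cancel]
  have lift_apply := π.liftOfRightInverse_comp_apply _ (Function.rightInverse_surjInv hπ) ⟨σ, hker⟩
  refine ⟨π.liftOfSurjective hπ ⟨σ, hker⟩, fun d => ?_, ?_⟩
  · simpa [π, σ] using lift_apply (.inl d)
  · simpa [π, σ] using lift_apply (.inr (.ofAdd 1))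

/-- The twist class of `φ`, encoded by the invariant that determines it: `φ` and `ψ` are twists of
each other when they agree on `D` and `φ f`, `ψ f` lie in the same left coset of `H` for every
`f`. -/
def twistClass (H : Subgroup G) (D : Subgroup F) (φ : F →* G) : (D →* G) × (F → G ⧸ H) :=
  (φ.comp D.subtype, fun f => φ f)

variable {H : Subgroup G} {φ ψ : F →* G}

theorem twistClass_eq_iff : twistClass H D φ = twistClass H D ψ ↔
    (∀ d ∈ D, φ d = ψ d) ∧ ∀ f, (φ f)⁻¹ * ψ f ∈ H := by
  simp [twistClass, Prod.ext_iff, MonoidHom.ext_iff, funext_iff, QuotientGroup.eq]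

theorem smul_twistClass {h : G} (hh : h ∈ H) :
    h • twistClass H D φ = twistClass H D (h • φ) := by
  refine Prod.ext rfl (funext fun f => ?_)
  change ((h * φ f : G) : G ⧸ H) = (h * φ f * h⁻¹ : G)
  exact (QuotientGroup.mk_mul_of_mem _ (inv_mem hh)).symm

/-- The elements of `G` by which a homomorphism in the twist class of `φ` can differ from `φ`: those
of `H` that centralize `φ D` and remain in `H` under conjugation by `φ F`. -/
def twistCore (H : Subgroup G) (D : Subgroup F) (φ : F →* G) : Subgroup G :=
  stabilizer G (twistClass H D φ)

theorem mem_twistCore_iff {g : G} : g ∈ twistCore H D φ ↔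
    (∀ d ∈ D, Commute g (φ d)) ∧ ∀ f, (φ f)⁻¹ * g * φ f ∈ H := by
  have hD (d : F) : g * φ d * g⁻¹ = φ d ↔ Commute g (φ d) := mul_inv_eq_iff_eq_mul
  have hcoset (f : F) : ((g * φ f : G) : G ⧸ H) = φ f ↔ (φ f)⁻¹ * g * φ f ∈ H := by
    rw [eq_comm, QuotientGroup.eq, mul_assoc]
  rw [twistCore, mem_stabilizer_iff, Prod.ext_iff, MonoidHom.ext_iff, funext_iff]
  simp only [← hD, ← hcoset]
  exact and_congr_left' Subtype.forall

theorem twistCore_le : twistCore H D φ ≤ H := fun g hg => by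
  simpa using (mem_twistCore_iff.1 hg).2 1

theorem inv_mul_mul_mem_twistCore [D.Normal] {g : G} (hg : g ∈ twistCore H D φ) (f : F) :
    (φ f)⁻¹ * g * φ f ∈ twistCore H D φ := by
  rw [mem_twistCore_iff] at hg ⊢
  refine ⟨fun d hd => ?_, fun f' => ?_⟩
  · have hcomm := hg.1 (f * d * f⁻¹) (‹D.Normal›.conj_mem d hd f)
    simpa [mul_assoc] using (Commute.conj_iff (φ f)⁻¹).2 hcomm
  · simpa [mul_assoc] using hg.2 (f * f')

theorem map_mem_normalizer_twistCore [D.Normal] (f : F) :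
    φ f ∈ Subgroup.normalizer (twistCore H D φ : Set G) := by
  refine Subgroup.mem_normalizer_iff''.2 fun g => ⟨(inv_mul_mul_mem_twistCore · f), fun hg => ?_⟩
  simpa [mul_assoc] using inv_mul_mul_mem_twistCore hg f⁻¹

theorem inv_mul_mem_twistCore [D.Normal] (h : twistClass H D ψ = twistClass H D φ) (f : F) :
    (φ f)⁻¹ * ψ f ∈ twistCore H D φ := by
  obtain ⟨hD, hH⟩ := twistClass_eq_iff.1 h.symm
  refine mem_twistCore_iff.2 ⟨fun d hd => ?_, fun f' => ?_⟩
  · have hφψ : ψ f * φ d * (ψ f)⁻¹ = φ f * φ d * (φ f)⁻¹ := by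
      have := hD (f * d * f⁻¹) (‹D.Normal›.conj_mem d hd f)
      simpa [hD d hd] using this.symm
    calc (φ f)⁻¹ * ψ f * φ d = (φ f)⁻¹ * (ψ f * φ d * (ψ f)⁻¹) * ψ f := by group
      _ = φ d * ((φ f)⁻¹ * ψ f) := by rw [hφψ]; group
  · have := H.mul_mem (hH (f * f')) (H.inv_mem (hH f'))
    simpa [mul_assoc] using this

theorem exists_twistClass_eq_of_mem_twistCore [D.Normal] {p a : ℕ} (hp : p.Prime)
    (hH : Nat.card H = p ^ a) (hindex : Nat.card H ∣ D.index)
    (ht : ∀ x : F ⧸ D, x ∈ Subgroup.zpowers (t : F ⧸ D)) {k : G} (hk : k ∈ twistCore H D φ) :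
    ∃ ψ : F →* G, twistClass H D ψ = twistClass H D φ ∧ ψ t = φ t * k := by
  have ht_order : orderOf (t : F ⧸ D) = D.index := orderOf_eq_card_of_forall_mem_zpowers ht
  have ht_mem : t ^ D.index ∈ D := by
    rw [← QuotientGroup.eq_one_iff, QuotientGroup.mk_pow, ← ht_order, pow_orderOf_eq_one]
  have hcore (d : F) (hd : d ∈ D) : Commute k (φ d) := (mem_twistCore_iff.1 hk).1 d hd
  have hpow : (φ t * k) ^ D.index = φ t ^ D.index := by
    have hK : Nat.card (twistCore H D φ) ∣ p ^ a := hH ▸ Subgroup.card_dvd_of_le twistCore_le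
    obtain ⟨b, -, hb⟩ := (Nat.dvd_prime_pow hp).1 hK
    refine mul_pow_eq_pow_of_card_dvd hp hb ((hK.trans hH.symm.dvd).trans hindex)
      (map_mem_normalizer_twistCore t) (fun x hx => ?_) hk
    rw [← map_pow]
    exact (mem_twistCore_iff.1 hx).1 _ ht_mem
  obtain ⟨ψ, hψD, hψt⟩ := exists_hom_extending ht (φ.comp D.subtype) (φ t * k)
    (fun d => by simp [mul_assoc, (hcore d d.2).eq])
    (fun d n hd => by
      obtain ⟨c, rfl⟩ : (D.index : ℤ) ∣ n := by
        rw [← ht_order, orderOf_dvd_iff_zpow_eq_one, ← QuotientGroup.mk_zpow, ← hd]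
        simp
      simp [hd, zpow_mul, hpow])
  refine ⟨ψ, Eq.symm <| twistClass_eq_iff.2 ⟨fun d hd => (hψD ⟨d, hd⟩).symm, fun f => ?_⟩, hψt⟩
  obtain ⟨d, hd, n, rfl⟩ := exists_mul_zpow_eq ht f
  have hψd : ψ d = φ d := hψD ⟨d, hd⟩
  have hmem := twistCore_le (inv_zpow_mul_mul_zpow_mem (map_mem_normalizer_twistCore t) hk n)
  simpa [hψd, hψt, mul_assoc] using hmem

theorem nonempty_fiber_twistClass_equiv_twistCore [D.Normal] {p a : ℕ} (hp : p.Prime)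
    (hH : Nat.card H = p ^ a) (hindex : Nat.card H ∣ D.index) [IsCyclic (F ⧸ D)] (φ : F →* G) :
    Nonempty ({ψ // twistClass H D ψ = twistClass H D φ} ≃ twistCore H D φ) := by
  obtain ⟨x, ht⟩ := IsCyclic.exists_generator (α := F ⧸ D)
  obtain ⟨t, rfl⟩ := QuotientGroup.mk_surjective x
  let e : {ψ // twistClass H D ψ = twistClass H D φ} → twistCore H D φ :=
    fun ψ => ⟨(φ t)⁻¹ * ψ.1 t, inv_mul_mem_twistCore ψ.2 t⟩
  refine ⟨Equiv.ofBijective e ⟨?_, ?_⟩⟩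
  · rintro ⟨ψ, hψ⟩ ⟨χ, hχ⟩ h
    have hD := (twistClass_eq_iff.1 (hψ.trans hχ.symm)).1
    exact Subtype.ext <| hom_ext_of_forall_mem_zpowers ht hD (mul_left_cancel (Subtype.ext_iff.1 h))
  · rintro ⟨k, hk⟩
    obtain ⟨ψ, hψ, hψt⟩ := exists_twistClass_eq_of_mem_twistCore hp hH hindex ht hk
    exact ⟨⟨ψ, hψ⟩, Subtype.ext (by simp [e, hψt])⟩

theorem card_dvd_card_of_smul_mem_of_twistClass_eq_of_prime_pow [D.Normal] {p a : ℕ} (hp : p.Prime)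
    (hH : Nat.card H = p ^ a) (hindex : Nat.card H ∣ D.index) [IsCyclic (F ⧸ D)] {Φ : Set (F →* G)}
    (hconj : ∀ h ∈ H, ∀ φ ∈ Φ, h • φ ∈ Φ)
    (htwist : ∀ φ ∈ Φ, ∀ ψ, twistClass H D ψ = twistClass H D φ → ψ ∈ Φ) :
    Nat.card H ∣ Nat.card Φ := by
  refine card_dvd_card_of_fiber_equiv_stabilizer (fun φ : Φ => twistClass H D φ.1)
    (fun h φ => ⟨⟨h • φ.1, hconj h h.2 _ φ.2⟩, (smul_twistClass h.2).symm⟩) fun φ => ?_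
  obtain ⟨e⟩ := nonempty_fiber_twistClass_equiv_twistCore hp hH hindex φ.1
  exact ⟨(Equiv.subtypeSubtypeEquivSubtype (htwist φ φ.2 _ ·)).trans <|
    e.trans (Subgroup.subgroupOfEquivOfLe twistCore_le).symm.toEquiv⟩

theorem card_dvd_card_of_smul_mem_of_twistClass_eq [Finite H] [D.Normal] [IsCyclic (F ⧸ D)]
    (hindex : Nat.card H ∣ D.index) {Φ : Set (F →* G)}
    (hconj : ∀ h ∈ H, ∀ φ ∈ Φ, h • φ ∈ Φ)
    (htwist : ∀ φ ∈ Φ, ∀ ψ, twistClass H D ψ = twistClass H D φ → ψ ∈ Φ) :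
    Nat.card H ∣ Nat.card Φ := by
  refine (Nat.dvd_iff_prime_pow_dvd_dvd _ _).2 fun p a hp hpa => ?_
  obtain ⟨P, hPH, hP⟩ := exists_le_card_eq_prime_pow hp hpa
  rw [← hP] at hpa ⊢
  refine card_dvd_card_of_smul_mem_of_twistClass_eq_of_prime_pow hp hP (hpa.trans hindex)
    (fun h hh => hconj h (hPH hh)) fun φ hφ ψ h => htwist φ hφ ψ ?_
  rw [twistClass_eq_iff] at h ⊢
  exact h.imp_right fun hψ f => hPH (hψ f)

end Hom

section FreeGroup

variable {ι κ : Type*} [Fintype ι] [Fintype κ]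

theorem exists_hom_int_ne_one_of_card_lt (w : κ → FreeGroup ι)
    (h : Fintype.card κ < Fintype.card ι) :
    ∃ χ : FreeGroup ι →* Multiplicative ℤ, χ ≠ 1 ∧ ∀ i, χ (w i) = 1 := by
  classical
  let expSum (j : ι) : FreeGroup ι →* Multiplicative ℤ :=
    FreeGroup.lift (Pi.mulSingle j (Multiplicative.ofAdd 1))
  let M : Matrix κ ι ℤ := .of fun i j => (expSum j (w i)).toAdd
  have hM : ¬ Function.Injective M.mulVecLin := fun hinj =>
    h.not_ge (card_le_of_injective ℤ M.mulVecLin hinj)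
  obtain ⟨v, hv, hv_ne⟩ : ∃ v, M.mulVec v = 0 ∧ v ≠ 0 := by
    simpa [injective_iff_map_eq_zero] using hM
  refine ⟨∏ j, expSum j ^ v j, fun hχ => hv_ne (funext fun j => ?_), fun i => ?_⟩
  · have := congrArg Multiplicative.toAdd (DFunLike.congr_fun hχ (FreeGroup.of j))
    simpa [expSum, MonoidHom.finsetProd_apply, Pi.mulSingle_apply] using this
  · refine Multiplicative.toAdd.injective (Eq.trans ?_ (congrFun hv i))
    simp [M, Matrix.mulVec, dotProduct, MonoidHom.finsetProd_apply, mul_comm]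

theorem exists_surjective_hom_int_ker_eq {F : Type*} [Group F] {χ : F →* Multiplicative ℤ}
    (hχ : χ ≠ 1) : ∃ χ' : F →* Multiplicative ℤ, Function.Surjective χ' ∧ χ'.ker = χ.ker := by
  have : Nontrivial χ.range := by
    rwa [Subgroup.nontrivial_iff_ne_bot, ne_eq, MonoidHom.range_eq_bot_iff]
  have : Infinite χ.range := inferInstance
  let e : χ.range ≃* Multiplicative ℤ := intCyclicMulEquiv.symm
  exact ⟨(e : χ.range →* Multiplicative ℤ).comp χ.rangeRestrict,
    e.surjective.comp χ.rangeRestrict_surjective, by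
    rw [MonoidHom.ker_mulEquiv_comp, MonoidHom.ker_rangeRestrict]⟩

theorem exists_surjective_hom_int_of_card_lt (w : κ → FreeGroup ι)
    (h : Fintype.card κ < Fintype.card ι) :
    ∃ χ : FreeGroup ι →* Multiplicative ℤ, Function.Surjective χ ∧ ∀ i, χ (w i) = 1 := by
  obtain ⟨χ₀, hχ₀, hw⟩ := exists_hom_int_ne_one_of_card_lt w h
  obtain ⟨χ, hχ, hker⟩ := exists_surjective_hom_int_ker_eq hχ₀
  exact ⟨χ, hχ, fun i => by rw [← MonoidHom.mem_ker, hker]; exact hw i⟩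

theorem exists_normal_isCyclic_quotient_index_eq (w : κ → FreeGroup ι)
    (h : Fintype.card κ < Fintype.card ι) (n : ℕ) :
    ∃ (D : Subgroup (FreeGroup ι)) (_ : D.Normal),
      IsCyclic (FreeGroup ι ⧸ D) ∧ D.index = n ∧ ∀ i, w i ∈ D := by
  obtain ⟨χ, hχ, hw⟩ := exists_surjective_hom_int_of_card_lt w h
  let q : FreeGroup ι →* Multiplicative (ZMod n) :=
    (Int.castAddHom (ZMod n)).toMultiplicative.comp χ
  have hq : Function.Surjective q := ZMod.intCast_surjective.comp hχ
  let e := QuotientGroup.quotientKerEquivOfSurjective q hq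
  exact ⟨q.ker, inferInstance, isCyclic_of_surjective e.symm e.symm.surjective,
    (Nat.card_congr e.toEquiv).trans (Nat.card_zmod n),
    fun i => by simp [MonoidHom.mem_ker, q, hw i]⟩

end FreeGroup

section Solutions

variable {F G R ι : Type*} [Group F] [Group G] [Ring R] [Fintype ι]

/-- The solutions of an equation `∑ᵢ ρ(wᵢ) = 1` in `G`, viewed as homomorphisms to `G` from the
group `F` that contains the words `wᵢ`. -/
def sumEqOneHoms (ρ : G →* Rˣ) (w : ι → F) : Set (F →* G) :=
  {φ | ∑ i, (ρ (φ (w i)) : R) = 1}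

variable {ρ : G →* Rˣ} {w : ι → F} {φ ψ : F →* G}

theorem smul_mem_sumEqOneHoms (g : G) (hφ : φ ∈ sumEqOneHoms ρ w) :
    g • φ ∈ sumEqOneHoms ρ w := by
  have hφ' : ∑ i, (ρ (φ (w i)) : R) = 1 := hφ
  simp only [sumEqOneHoms, Set.mem_ofPred_eq, smul_hom_apply, map_mul, map_inv, Units.val_mul]
  rw [← Finset.sum_mul, ← Finset.mul_sum, hφ', mul_one, Units.mul_inv]

theorem mem_sumEqOneHoms_congr (h : ∀ i, φ (w i) = ψ (w i)) :
    φ ∈ sumEqOneHoms ρ w ↔ ψ ∈ sumEqOneHoms ρ w := by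
  simp only [sumEqOneHoms, Set.mem_ofPred_eq, h]

theorem card_dvd_card_sumEqOneHoms {H : Subgroup G} [Finite H] {D : Subgroup F} [D.Normal]
    [IsCyclic (F ⧸ D)] (hindex : Nat.card H ∣ D.index) (hw : ∀ i, w i ∈ D) :
    Nat.card H ∣ Nat.card (sumEqOneHoms ρ w) :=
  card_dvd_card_of_smul_mem_of_twistClass_eq hindex (fun h _ _ => smul_mem_sumEqOneHoms h)
    fun _ hφ _ h => (mem_sumEqOneHoms_congr fun i => (twistClass_eq_iff.1 h).1 _ (hw i)).2 hφ

end Solutions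

theorem card_solutionSet_eq {G R : Type*} [Group G] [Ring R] (ρ : G →* Rˣ)
    {k m : ℕ} (u : Fin k → FreeGroup (Fin m)) (l : Fin k → ℤ) :
    Nat.card (solutionSet ρ u l) = Nat.card (sumEqOneHoms ρ fun i => u i ^ l i) :=
  Nat.card_congr <| FreeGroup.lift.subtypeEquiv fun x => by
    simp [solutionSet, sumEqOneHoms]

theorem card_dvd_card_solutionSet {G R : Type*} [Group G] [Ring R] (ρ : G →* Rˣ)
    {k m : ℕ} (u : Fin k → FreeGroup (Fin m)) (l : Fin k → ℤ) (H : Subgroup G) [Finite H]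
    (I : Finset (Fin k)) (hI : I.card < m) (hl : ∀ i ∉ I, (Nat.card H : ℤ) ∣ l i) :
    Nat.card H ∣ Nat.card (solutionSet ρ u l) := by
  obtain ⟨D, _, _, hindex, hD⟩ := exists_normal_isCyclic_quotient_index_eq (fun i : I => u i)
    (by simpa using hI) (Nat.card H)
  rw [card_solutionSet_eq]
  refine card_dvd_card_sumEqOneHoms hindex.symm.dvd fun i => ?_
  by_cases hi : i ∈ I
  · exact zpow_mem (hD ⟨i, hi⟩) _
  · obtain ⟨c, hc⟩ := hl i hi
    rw [hc, ← hindex, zpow_mul, zpow_natCast]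
    exact zpow_mem (D.pow_index_mem (u i)) c

theorem exists_pow_dvd_of_pow_dvd_lcm {α ι : Type*} [CommMonoidWithZero α]
    [NormalizedGCDMonoid α] {p : α} (hp : Prime p) {s : Finset ι} {f : ι → α} {a : ℕ} (ha : a ≠ 0)
    (h : p ^ a ∣ s.lcm f) : ∃ i ∈ s, p ^ a ∣ f i := by
  obtain ⟨b, rfl⟩ := Nat.exists_eq_add_one_of_ne_zero ha
  by_contra! hndvd
  have hsplit (i : ι) (hi : i ∈ s) : ∃ c, f i ∣ p ^ b * c ∧ ¬ p ∣ c := by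
    have hfin : FiniteMultiplicity p (f i) := ⟨b, hndvd i hi⟩
    obtain ⟨c, hc, hpc⟩ := hfin.exists_eq_pow_mul_and_not_dvd
    have hle : multiplicity p (f i) ≤ b :=
      Nat.lt_succ_iff.1 (hfin.multiplicity_lt_iff_not_dvd.2 (hndvd i hi))
    exact ⟨c, hc.symm ▸ mul_dvd_mul_right (pow_dvd_pow p hle) c, hpc⟩
  choose! c hc hpc using hsplit
  have hlcm : s.lcm f ∣ p ^ b * ∏ i ∈ s, c i := Finset.lcm_dvd fun i hi =>
    (hc i hi).trans (mul_dvd_mul_left _ (Finset.dvd_prod_of_mem c hi))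
  have hdvd : p ∣ ∏ i ∈ s, c i := by
    have := h.trans hlcm
    rwa [pow_succ, mul_dvd_mul_iff_left (pow_ne_zero b hp.ne_zero)] at this
  obtain ⟨i, hi, hpi⟩ := (hp.dvd_finsetProd_iff c).1 hdvd
  exact hpc i hi hpi

theorem groupGCD_dvd {G : Type*} [Group G] [Finite G] {n : ℤ} {N : ℕ}
    (h : ∀ H : Subgroup G, (Nat.card H : ℤ) ∣ n → Nat.card H ∣ N) : groupGCD G n ∣ N :=
  Finset.lcm_dvd fun H hH => h H (by simpa using hH)

theorem card_dvd_card_solutionSet_of_dvd_lcm {G R : Type*} [Group G] [Ring R] (ρ : G →* Rˣ)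
    {k m : ℕ} (hkm : k ≤ m) (u : Fin k → FreeGroup (Fin m)) (l : Fin k → ℤ)
    (H : Subgroup G) [Finite H] (hl : (Nat.card H : ℤ) ∣ Finset.univ.lcm l) :
    Nat.card H ∣ Nat.card (solutionSet ρ u l) := by
  refine (Nat.dvd_iff_prime_pow_dvd_dvd _ _).2 fun p a hp hpa => ?_
  rcases eq_or_ne a 0 with rfl | ha
  · simp
  obtain ⟨P, -, hP⟩ := exists_le_card_eq_prime_pow hp hpa
  have : Finite P := Nat.finite_of_card_ne_zero (hP ▸ (pow_pos hp.pos a).ne')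
  have hpl : (p : ℤ) ^ a ∣ Finset.univ.lcm l := dvd_trans (by exact_mod_cast hpa) hl
  obtain ⟨j, -, hj⟩ := exists_pow_dvd_of_pow_dvd_lcm (Nat.prime_iff_prime_int.1 hp) ha hpl
  rw [← hP]
  refine card_dvd_card_solutionSet ρ u l P (Finset.univ.erase j) ?_ fun i hi => ?_
  · rw [Finset.card_erase_of_mem (Finset.mem_univ j), Finset.card_fin]
    have := j.pos
    lia
  · obtain rfl : i = j := by simpa using hi
    rwa [hP, Nat.cast_pow]

theorem mainTheorem6 {G R : Type*} [Group G] [Finite G] [Ring R] (ρ : G →* Rˣ)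
    (k m : ℕ) (hm : 1 ≤ m) (u : Fin k → FreeGroup (Fin m)) (l : Fin k → ℤ) :
    groupGCD G (Finset.univ.gcd l) ∣ Nat.card (solutionSet ρ u l) ∧
    (k ≤ m → groupGCD G (Finset.univ.lcm l) ∣ Nat.card (solutionSet ρ u l)) ∧
    (k < m → Nat.card G ∣ Nat.card (solutionSet ρ u l)) := by
  refine ⟨groupGCD_dvd fun H hH => ?_, fun hkm => groupGCD_dvd fun H hH => ?_, fun hkm => ?_⟩
  · exact card_dvd_card_solutionSet ρ u l H ∅ (by rwa [Finset.card_empty])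
      fun i _ => hH.trans (Finset.gcd_dvd (Finset.mem_univ i))
  · exact card_dvd_card_solutionSet_of_dvd_lcm ρ hkm u l H hH
  · simpa using card_dvd_card_solutionSet ρ u l ⊤ Finset.univ (by simpa using hkm) (by simp)
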